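/- A polyhedron in $\mathbb{R}^q$ is the solution set of finitely many linear inequalities, a polytope in $\mathbb{R}^p$ is the convex hull of a finite set of points, and a facet of a polyhedron $Q$ is a nonempty face of $Q$ of dimension $\dim(Q)-1$. An extension of a polytope $P \subseteq \mathbb{R}^p$ is a pair $(Q,\pi)$ consisting of a polyhedron $Q \subseteq \mathbb{R}^q$ (for some $q$) and a linear map $\pi\colon \mathbb{R}^q \to \mathbb{R}^p$ with $\pi(Q) = P$; its size is the number of facets of $Q$. The extension complexity $\mathrm{xc}(P)$ is the smallest size of any extension of $P$. Proposition. Let $P \subseteq \mathbb{R}^p$ be a polytope of dimension $d \geq 1$. Then: (a) $\mathrm{xc}(P) \geq d+1$; (b) $\mathrm{xc}(P) = d+1$ if and only if $P$ is a simplex; (c) $\mathrm{xc}(P) = d+2$ if and only if $\min\{\#\mathrm{facets}(P), \#\mathrm{vertices}(P)\} = d+2$. -/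

import Mathlib

namespace ExtForm

/-- A polyhedron in `ℝ^q`: the solution set of a finite system of linear inequalities. -/
def IsPolyhedron {q : ℕ} (Q : Set (Fin q → ℝ)) : Prop :=
  ∃ (m : ℕ) (A : Matrix (Fin m) (Fin q) ℝ) (b : Fin m → ℝ),
    Q = {y | ∀ i, A.mulVec y i ≤ b i}

/-- A polytope in `ℝ^p`: the convex hull of a finite set of points. -/
def IsPolytope {p : ℕ} (P : Set (Fin p → ℝ)) : Prop :=
  ∃ V : Set (Fin p → ℝ), V.Finite ∧ P = convexHull ℝ V

/-- The dimension of a nonempty set in `ℝ^p`, i.e. the dimension of its affine hull. -/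
noncomputable def dim {p : ℕ} (S : Set (Fin p → ℝ)) : ℕ :=
  Module.finrank ℝ (vectorSpan ℝ S)

/-- The facets of a polyhedron `Q`: its nonempty faces of dimension `dim Q - 1`. A nonempty face
is the set of points of `Q` at which some linear functional attains its maximum over `Q`. -/
def facets {q : ℕ} (Q : Set (Fin q → ℝ)) : Set (Set (Fin q → ℝ)) :=
  {F | F.Nonempty ∧ IsExposed ℝ Q F ∧ dim F + 1 = dim Q}

/-- The vertices of a polytope are its extreme points. -/
def vertices {p : ℕ} (P : Set (Fin p → ℝ)) : Set (Fin p → ℝ) :=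
  Set.extremePoints ℝ P

/-- `(Q, π)` is an extension of `P`: `Q` is a polyhedron, `π` is linear and `π(Q) = P`. -/
def IsExtension {p q : ℕ} (P : Set (Fin p → ℝ)) (Q : Set (Fin q → ℝ))
    (π : (Fin q → ℝ) →ₗ[ℝ] (Fin p → ℝ)) : Prop :=
  IsPolyhedron Q ∧ π '' Q = P

/-- The extension complexity of `P`: the smallest number of facets of `Q` over all
extensions `(Q, π)` of `P`, with `Q` in a space `ℝ^q` of any dimension. -/
noncomputable def xc {p : ℕ} (P : Set (Fin p → ℝ)) : ℕ∞ :=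
  sInf {n | ∃ (q : ℕ) (Q : Set (Fin q → ℝ)) (π : (Fin q → ℝ) →ₗ[ℝ] (Fin p → ℝ)),
    IsExtension P Q π ∧ n = (facets Q).encard}

/-- A simplex: the convex hull of finitely many (at least one) affinely independent points. -/
def IsSimplex {p : ℕ} (P : Set (Fin p → ℝ)) : Prop :=
  ∃ (n : ℕ) (s : Affine.Simplex ℝ (Fin p → ℝ) n), P = convexHull ℝ (Set.range s.points)

end ExtForm

/-!
The key is the slack description of an extension. A polyhedron with `n` facets is described inside
its affine hull by `n` inequalities (`IsPolyhedron.exists_facet_description`). Passing to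
the slacks, a bounded `P` with an extension of size `n` is an affine image of a slice of an orthant
in at most `n` dimensions; after dropping all inequalities not needed for the projection, the
slice has no recession directions (`exists_slice`, `Slice`). So its space of directions `U` is a
proper subspace of `ℝ^m`, `m ≤ n`, and since the slice projects onto `P`,
`dim P ≤ dim U ≤ m - 1`, which gives the lower bound `dim P + 1` (`dim_add_one_le_xc`).

If `dim U = m - 1`, the slice is a simplex with `m` vertices or a point, and `P` is the convex hull
of `m` points (`Slice.exists_eq_convexHull`). If `dim U = dim P`, the projection is injective on
the slice, so that `P` is given by `m` inequalities and has at most `m` facets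
(`Slice.encard_facets_le_card`). For `n ≤ dim P + 2` no other case is possible. Hence an extension
of size `dim P + 1` makes `P` a simplex, and one of size `dim P + 2` forces at most `dim P + 2`
facets or at most `dim P + 2` vertices.

In the other direction, the extension complexity is at most the number of facets, because
a polytope is a polyhedron and so an extension of itself (`IsPolytope.isPolyhedron`, by
Fourier–Motzkin elimination), and at most the number of vertices, because a polytope is
a projection of a standard simplex (`IsPolytope.xc_le_encard_vertices`).
-/

/-! ### Polyhedral sets and Fourier–Motzkin elimination -/

namespace ExtForm

open Module

section Polyhedral

variable {E : Type*} [AddCommGroup E] [Module ℝ E]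

/-- A subset of a real vector space is polyhedral if it is the solution set of finitely many
linear inequalities. This is `IsPolyhedron` without coordinates and with a free index type. -/
def IsPolyhedral (S : Set E) : Prop :=
  ∃ (ι : Type) (_ : Fintype ι) (f : ι → Dual ℝ E) (b : ι → ℝ), S = {x | ∀ i, f i x ≤ b i}

theorem isPolyhedron_iff_isPolyhedral {q : ℕ} {Q : Set (Fin q → ℝ)} :
    IsPolyhedron Q ↔ IsPolyhedral Q := by
  constructor
  · rintro ⟨m, A, b, rfl⟩
    exact ⟨Fin m, inferInstance, fun i => LinearMap.proj i ∘ₗ A.mulVecLin, b, rfl⟩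
  · rintro ⟨ι, _, f, b, rfl⟩
    let e := Fintype.equivFin ι
    refine ⟨Fintype.card ι, LinearMap.toMatrix' (LinearMap.pi fun k => f (e.symm k)),
      fun k => b (e.symm k), ?_⟩
    ext y
    simp only [Set.mem_ofPred_eq, LinearMap.toMatrix'_mulVec, LinearMap.pi_apply]
    exact e.symm.surjective.forall

theorem IsPolyhedral.inter {S T : Set E} (hS : IsPolyhedral S) (hT : IsPolyhedral T) :
    IsPolyhedral (S ∩ T) := by
  obtain ⟨ι, _, f, b, rfl⟩ := hS
  obtain ⟨κ, _, g, c, rfl⟩ := hT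
  refine ⟨ι ⊕ κ, inferInstance, Sum.elim f g, Sum.elim b c, ?_⟩
  ext x
  simp [Sum.forall]

theorem isPolyhedral_setOf_eq (f : Dual ℝ E) (b : ℝ) : IsPolyhedral {x | f x = b} := by
  refine ⟨Bool, inferInstance, fun i => cond i f (-f), fun i => cond i b (-b), ?_⟩
  ext x
  simp [Bool.forall_bool, le_antisymm_iff, and_comm]

theorem IsPolyhedral.preimage_add {F : Type*} [AddCommGroup F] [Module ℝ F] {S : Set E}
    (hS : IsPolyhedral S) (A : F →ₗ[ℝ] E) (x₀ : E) : IsPolyhedral {y | A y + x₀ ∈ S} := by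
  obtain ⟨ι, _, f, b, rfl⟩ := hS
  refine ⟨ι, inferInstance, fun i => f i ∘ₗ A, fun i => b i - f i x₀, ?_⟩
  ext y
  simp [le_sub_iff_add_le]

theorem isPolyhedral_singleton_zero [FiniteDimensional ℝ E] : IsPolyhedral ({0} : Set E) := by
  let B := finBasis ℝ E
  refine ⟨Fin (finrank ℝ E) × Bool, inferInstance,
    fun i => cond i.2 (B.coord i.1) (-B.coord i.1), fun _ => 0, ?_⟩
  ext x
  rw [Set.mem_singleton_iff, ← B.forall_coord_eq_zero_iff]
  simp [Prod.forall, Bool.forall_bool, le_antisymm_iff, and_comm]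

theorem exists_between_of_finite {ι κ : Type*} [Finite ι] [Finite κ] (l : ι → ℝ) (u : κ → ℝ)
    (h : ∀ i j, l i ≤ u j) : ∃ t, (∀ i, l i ≤ t) ∧ ∀ j, t ≤ u j := by
  rcases isEmpty_or_nonempty ι with _ | _
  · rcases isEmpty_or_nonempty κ with _ | _
    · exact ⟨0, by simp, by simp⟩
    · obtain ⟨j, hj⟩ := Finite.exists_min u
      exact ⟨u j, by simp, hj⟩
  · obtain ⟨i, hi⟩ := Finite.exists_max l
    exact ⟨l i, hi, h i⟩

/-- Fourier–Motzkin elimination of one real variable. -/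
theorem isPolyhedral_setOf_exists {ι : Type} [Fintype ι] (f : ι → Dual ℝ E) (c b : ι → ℝ) :
    IsPolyhedral {x | ∃ t : ℝ, ∀ i, f i x + t * c i ≤ b i} := by
  classical
  refine ⟨{i // c i = 0} ⊕ ({i // 0 < c i} × {j // c j < 0}), inferInstance,
    Sum.elim (fun i => f i) (fun k => c k.1 • f k.2 - c k.2 • f k.1),
    Sum.elim (fun i => b i) (fun k => c k.1 * b k.2 - c k.2 * b k.1), ?_⟩
  ext x
  simp only [Set.mem_ofPred_eq, Sum.forall, Sum.elim_inl, Sum.elim_inr, Prod.forall,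
    Subtype.forall, LinearMap.sub_apply, LinearMap.smul_apply, smul_eq_mul]
  constructor
  · rintro ⟨t, ht⟩
    refine ⟨fun i hi => by simpa [hi] using ht i, fun i hi j hj => ?_⟩
    have h1 := mul_le_mul_of_nonneg_left (ht j) hi.le
    have h2 := mul_le_mul_of_nonpos_left (ht i) hj.le
    linarith
  · rintro ⟨h0, h1⟩
    obtain ⟨t, hl, hu⟩ := exists_between_of_finite
      (fun j : {j // c j < 0} => (b j - f j x) / c j)
      (fun i : {i // 0 < c i} => (b i - f i x) / c i) (by
        rintro ⟨j, hj⟩ ⟨i, hi⟩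
        rw [div_le_iff_of_neg hj, div_mul_eq_mul_div, div_le_iff₀ hi]
        linarith [h1 i hi j hj])
    refine ⟨t, fun i => ?_⟩
    rcases lt_trichotomy (c i) 0 with hi | hi | hi
    · have := (div_le_iff_of_neg hi).1 (hl ⟨i, hi⟩)
      linarith
    · simpa [hi] using h0 i hi
    · have := (le_div_iff₀ hi).1 (hu ⟨i, hi⟩)
      linarith

/-- Adding a ray to a polyhedral set keeps it polyhedral. -/
theorem IsPolyhedral.add_ray {S : Set E} (hS : IsPolyhedral S) (v : E) :
    IsPolyhedral {x | ∃ t : ℝ, 0 ≤ t ∧ x - t • v ∈ S} := by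
  obtain ⟨ι, _, f, b, rfl⟩ := hS
  convert isPolyhedral_setOf_exists (fun i : Option ι => i.elim 0 f)
    (fun i => i.elim (-1) fun i => -f i v) (fun i => i.elim 0 b) using 5 with x t
  simp [Option.forall, sub_eq_add_neg]

/-- The cone generated by finitely many vectors is polyhedral. -/
theorem isPolyhedral_cone [FiniteDimensional ℝ E] (s : Finset E) :
    IsPolyhedral {x : E | ∃ w : E → ℝ, (∀ v ∈ s, 0 ≤ w v) ∧ ∑ v ∈ s, w v • v = x} := by
  classical
  induction s using Finset.induction_on with
  | empty =>
    convert isPolyhedral_singleton_zero (E := E) using 1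
    ext x
    simp [eq_comm]
  | insert v s hv ih =>
    convert ih.add_ray v using 1
    ext x
    constructor
    · rintro ⟨w, hw, rfl⟩
      refine ⟨w v, hw v (Finset.mem_insert_self _ _), w,
        fun y hy => hw y (Finset.mem_insert_of_mem hy), ?_⟩
      rw [Finset.sum_insert hv]
      abel
    · rintro ⟨t, ht, w, hw, hx⟩
      have hne : ∀ y ∈ s, y ≠ v := fun y hy h => hv (h ▸ hy)
      refine ⟨Function.update w v t, ?_, ?_⟩
      · intro y hy
        rcases Finset.mem_insert.1 hy with rfl | hy
        · simpa using ht
        · simpa [Function.update_of_ne (hne y hy)] using hw y hy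
      · rw [Finset.sum_insert hv, Function.update_self,
          Finset.sum_congr rfl fun y hy => by rw [Function.update_of_ne (hne y hy)], hx]
        abel

/-- The convex hull of `s` is the slice at height `1` of the cone over `s × {1}`. -/
theorem isPolyhedral_convexHull [FiniteDimensional ℝ E] (s : Finset E) :
    IsPolyhedral (convexHull ℝ (s : Set E)) := by
  classical
  convert (isPolyhedral_cone (s.map ⟨fun v => (v, (1 : ℝ)), fun _ _ h => congrArg Prod.fst h⟩)
    ).preimage_add (LinearMap.inl ℝ E ℝ) (0, 1) using 1
  ext x
  simp only [Finset.mem_convexHull', Set.mem_ofPred_eq, Finset.sum_map,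
    Finset.forall_mem_map, LinearMap.inl_apply, Prod.mk_add_mk,
    add_zero, zero_add, Prod.ext_iff, Prod.fst_sum, Prod.snd_sum, Prod.smul_fst, Prod.smul_snd,
    smul_eq_mul]
  constructor
  · rintro ⟨w, h0, h1, hx⟩
    exact ⟨fun y => w y.1, h0, hx, (Finset.sum_congr rfl fun v _ => mul_one (w v)).trans h1⟩
  · rintro ⟨w, h0, hx, h1⟩
    exact ⟨fun y => w (y, 1), h0,
      (Finset.sum_congr rfl fun v _ => (mul_one (w (v, 1))).symm).trans h1, hx⟩

end Polyhedral

/-- One half of the Minkowski–Weyl theorem. -/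
theorem IsPolytope.isPolyhedron {p : ℕ} {P : Set (Fin p → ℝ)} (hP : IsPolytope P) :
    IsPolyhedron P := by
  obtain ⟨V, hV, rfl⟩ := hP
  rw [isPolyhedron_iff_isPolyhedral, ← hV.coe_toFinset]
  exact isPolyhedral_convexHull _

end ExtForm

/-! ### Facets and inequality descriptions -/

namespace ExtForm

open Module Filter Topology

section Strict

variable {E : Type*} [AddCommGroup E] [Module ℝ E]

/-- In a convex set, valid inequalities that are each strict somewhere are strict at a common
point. -/
theorem exists_forall_lt_of_convex {s : Set E} (hs : Convex ℝ s) (hne : s.Nonempty)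
    {ι : Type*} [Finite ι] (f : ι → Dual ℝ E) (b : ι → ℝ) (hle : ∀ x ∈ s, ∀ i, f i x ≤ b i)
    {p : ι → Prop} (h : ∀ i, p i → ∃ x ∈ s, f i x < b i) :
    ∃ x ∈ s, ∀ i, p i → f i x < b i := by
  classical
  have := Fintype.ofFinite ι
  suffices H : ∀ t : Finset ι, ∃ x ∈ s, ∀ i ∈ t, p i → f i x < b i by
    obtain ⟨x, hx, hxt⟩ := H Finset.univ
    exact ⟨x, hx, fun i => hxt i (Finset.mem_univ i)⟩
  intro t
  induction t using Finset.induction_on with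
  | empty => exact ⟨hne.some, hne.some_mem, by simp⟩
  | insert i t _ ih =>
    obtain ⟨x, hx, hxt⟩ := ih
    by_cases hi : p i
    · obtain ⟨y, hy, hyi⟩ := h i hi
      refine ⟨(1 / 2 : ℝ) • x + (1 / 2 : ℝ) • y,
        hs hx hy (by norm_num) (by norm_num) (by norm_num), fun j hj hpj => ?_⟩
      have e : f j ((1 / 2 : ℝ) • x + (1 / 2 : ℝ) • y) = (f j x + f j y) / 2 := by
        simp only [map_add, map_smul, smul_eq_mul]; ring
      rw [e]
      have hxj := hle x hx j
      have hyj := hle y hy j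
      rcases Finset.mem_insert.1 hj with rfl | hj
      · linarith
      · linarith [hxt j hj hpj]
    · refine ⟨x, hx, fun j hj hpj => ?_⟩
      rcases Finset.mem_insert.1 hj with rfl | hj
      · exact absurd hpj hi
      · exact hxt j hj hpj

theorem exists_pos_forall_add_smul_lt {ι : Type*} [Finite ι] (f : ι → Dual ℝ E) (b : ι → ℝ)
    {p : ι → Prop} {z : E} (h : ∀ i, p i → f i z < b i) (v : E) :
    ∃ ε : ℝ, 0 < ε ∧ ∀ i, p i → f i (z + ε • v) < b i := by
  have key : ∀ᶠ ε in 𝓝[>] (0 : ℝ), ∀ i, p i → f i (z + ε • v) < b i := by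
    rw [eventually_all]
    intro i
    by_cases hi : p i
    · have hc : ContinuousAt (fun ε : ℝ => f i z + ε * f i v) 0 := by fun_prop
      have := (hc.eventually_lt (continuousAt_const (y := b i)) (by simpa using h i hi))
      filter_upwards [this.filter_mono nhdsWithin_le_nhds] with ε hε _
      simpa using hε
    · exact Eventually.of_forall fun _ h => absurd h hi
  obtain ⟨ε, h1, h2⟩ := (key.and self_mem_nhdsWithin).exists
  exact ⟨ε, h2, h1⟩

theorem finrank_inf_ker_add_one [FiniteDimensional ℝ E] {W : Submodule ℝ E} {f : Dual ℝ E}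
    {w : E} (hw : w ∈ W) (hf : f w ≠ 0) :
    finrank ℝ (W ⊓ LinearMap.ker f : Submodule ℝ E) + 1 = finrank ℝ W := by
  have h1 : f.domRestrict W ≠ 0 := fun h => hf (by simpa using LinearMap.congr_fun h ⟨w, hw⟩)
  have h2 : W ⊓ LinearMap.ker f = (LinearMap.ker (f.domRestrict W)).map W.subtype := by
    ext x
    simp [and_comm]
  rw [h2, Submodule.finrank_map_subtype_eq, Module.Dual.finrank_ker_add_one_of_ne_zero h1]

end Strict

variable {q : ℕ}

/-- A facet of `{y ∈ x₀ + W | ∀ i, f i y ≤ b i}` is cut out by turning one of the inequalities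
into an equation: were each inequality that is not an equation on `Q` strict somewhere on the
facet `F`, then `F` would contain a point at which all of them are strict, and an exposed face
containing such a point is all of `Q`. -/
theorem exists_eq_of_mem_facets {ι : Type*} [Finite ι] {Q : Set (Fin q → ℝ)}
    {W : Submodule ℝ (Fin q → ℝ)} {x₀ : Fin q → ℝ} {f : ι → Dual ℝ (Fin q → ℝ)} {b : ι → ℝ}
    (hQ : Q = {y | y - x₀ ∈ W ∧ ∀ i, f i y ≤ b i}) {F : Set (Fin q → ℝ)} (hF : F ∈ facets Q) :
    ∃ i, {y ∈ Q | f i y = b i} = F := by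
  obtain ⟨hne, hexp, hdim⟩ := hF
  obtain ⟨l, hl⟩ := hexp hne
  have hFQ : F ⊆ Q := by rw [hl]; exact fun y hy => hy.1
  have hQmem : ∀ y, y ∈ Q ↔ y - x₀ ∈ W ∧ ∀ i, f i y ≤ b i := fun y => by rw [hQ]; rfl
  have hQconv : Convex ℝ Q := by
    intro x hx y hy s t hs ht hst
    rw [hQmem] at *
    refine ⟨?_, fun i => ?_⟩
    · have : s • x + t • y - x₀ = s • (x - x₀) + t • (y - x₀) := by
        rw [smul_sub, smul_sub, sub_add_sub_comm, ← add_smul, hst, one_smul]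
      rw [this]
      exact W.add_mem (W.smul_mem _ hx.1) (W.smul_mem _ hy.1)
    · have h1 := mul_le_mul_of_nonneg_left (hx.2 i) hs
      have h2 := mul_le_mul_of_nonneg_left (hy.2 i) ht
      have h3 : s * b i + t * b i = b i := by rw [← add_mul, hst, one_mul]
      simp only [map_add, map_smul, smul_eq_mul]
      linarith
  have hFconv : Convex ℝ F := (hexp.convex hQconv)
  by_cases H : ∀ i, (∃ y ∈ Q, f i y < b i) → ∃ y ∈ F, f i y < b i
  · exfalso
    obtain ⟨z, hz, hzlt⟩ := exists_forall_lt_of_convex hFconv hne f b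
      (fun x hx => ((hQmem x).1 (hFQ hx)).2) H
    have hFeq : F = Q := by
      refine hFQ.antisymm fun y hy => ?_
      obtain ⟨ε, hε, hεlt⟩ := exists_pos_forall_add_smul_lt f b hzlt (z - y)
      have hmem : z + ε • (z - y) ∈ Q := by
        have hz' := (hQmem z).1 (hFQ hz)
        have hy' := (hQmem y).1 hy
        rw [hQmem]
        refine ⟨?_, fun i => ?_⟩
        · have : z + ε • (z - y) - x₀ = (z - x₀) + ε • ((z - x₀) - (y - x₀)) := by
            rw [sub_sub_sub_cancel_right]; abel
          rw [this]
          exact W.add_mem hz'.1 (W.smul_mem _ (W.sub_mem hz'.1 hy'.1))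
        · by_cases hi : ∃ y ∈ Q, f i y < b i
          · exact (hεlt i hi).le
          · have hconst : ∀ y ∈ Q, f i y = b i := fun y hy =>
              le_antisymm (((hQmem y).1 hy).2 i) (not_lt.1 fun h => hi ⟨y, hy, h⟩)
            simp [hconst z (hFQ hz), hconst y hy]
      rw [hl] at hz ⊢
      have h1 := hz.2 _ hmem
      simp only [map_add, map_smul, map_sub, smul_eq_mul] at h1
      have h2 : l z ≤ l y := by
        have : ε * (l z - l y) ≤ 0 := by linarith
        nlinarith [(mul_nonpos_iff_pos_imp_nonpos.1 this).1 hε]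
      exact ⟨hy, fun x hx => (hz.2 x hx).trans h2⟩
    rw [hFeq] at hdim
    omega
  · push Not at H
    obtain ⟨i, ⟨y₁, hy₁, hlt⟩, hi⟩ := H
    refine ⟨i, ?_⟩
    have hFi : ∀ y ∈ F, f i y = b i := fun y hy =>
      le_antisymm (((hQmem y).1 (hFQ hy)).2 i) (hi y hy)
    obtain ⟨z, hz⟩ := hne
    have hK : vectorSpan ℝ F = vectorSpan ℝ Q ⊓ LinearMap.ker (f i) := by
      refine Submodule.eq_of_le_of_finrank_eq (le_inf (vectorSpan_mono ℝ hFQ) ?_) ?_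
      · rw [vectorSpan_def, Submodule.span_le]
        rintro _ ⟨x, hx, y, hy, rfl⟩
        simp [hFi x hx, hFi y hy]
      · have h1 : y₁ - z ∈ vectorSpan ℝ Q := vsub_mem_vectorSpan ℝ hy₁ (hFQ hz)
        have h2 : f i (y₁ - z) ≠ 0 := by
          rw [map_sub, hFi z hz]
          exact (sub_neg.2 hlt).ne
        have h3 := finrank_inf_ker_add_one h1 h2
        unfold dim at hdim
        omega
    have hlF : vectorSpan ℝ F ≤ LinearMap.ker l.toLinearMap := by
      rw [vectorSpan_def, Submodule.span_le]
      rintro _ ⟨x, hx, y, hy, rfl⟩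
      rw [hl] at hx hy
      have hxy : l x = l y := le_antisymm (hy.2 x hx.1) (hx.2 y hy.1)
      simp [hxy]
    ext y
    refine ⟨fun hy => ?_, fun hy => ⟨hFQ hy, hFi y hy⟩⟩
    have h1 : y - z ∈ vectorSpan ℝ F := by
      rw [hK]
      exact ⟨vsub_mem_vectorSpan ℝ hy.1 (hFQ hz), by simp [hy.2, hFi z hz]⟩
    have h2 : l y = l z := by simpa [sub_eq_zero] using hlF h1
    rw [hl] at hz ⊢
    exact ⟨hy.1, fun x hx => (hz.2 x hx).trans h2.ge⟩

theorem encard_facets_le {ι : Type*} [Fintype ι] {Q : Set (Fin q → ℝ)}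
    {W : Submodule ℝ (Fin q → ℝ)} {x₀ : Fin q → ℝ} {f : ι → Dual ℝ (Fin q → ℝ)} {b : ι → ℝ}
    (hQ : Q = {y | y - x₀ ∈ W ∧ ∀ i, f i y ≤ b i}) :
    (facets Q).encard ≤ Fintype.card ι := by
  calc (facets Q).encard ≤ ((fun i => {y ∈ Q | f i y = b i}) '' Set.univ).encard :=
        Set.encard_le_encard fun F hF => by
          obtain ⟨i, hi⟩ := exists_eq_of_mem_facets hQ hF
          exact ⟨i, trivial, hi⟩
    _ ≤ (Set.univ : Set ι).encard := Set.encard_image_le _ _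
    _ = Fintype.card ι := by simp [Set.encard_univ]

/-- Let `x₀` satisfy all inequalities strictly and let `z` lie on the `i`-th hyperplane and
satisfy the other inequalities strictly. Then the `i`-th hyperplane cuts out a facet. -/
theorem mem_facets_of_strict {ι : Type*} [Finite ι] {Q : Set (Fin q → ℝ)}
    {W : Submodule ℝ (Fin q → ℝ)} {x₀ : Fin q → ℝ} {f : ι → Dual ℝ (Fin q → ℝ)} {b : ι → ℝ}
    {J : Set ι} (hQ : Q = {y | y - x₀ ∈ W ∧ ∀ i ∈ J, f i y ≤ b i})
    (hx₀ : ∀ i ∈ J, f i x₀ < b i) {i : ι} (hi : i ∈ J) {z : Fin q → ℝ} (hzW : z - x₀ ∈ W)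
    (hzi : f i z = b i) (hz : ∀ j ∈ J, j ≠ i → f j z < b j) :
    {y ∈ Q | f i y = b i} ∈ facets Q := by
  have hQmem : ∀ y, y ∈ Q ↔ y - x₀ ∈ W ∧ ∀ i ∈ J, f i y ≤ b i := fun y => by rw [hQ]; rfl
  have hzQ : z ∈ Q := (hQmem z).2 ⟨hzW, fun j hj => by
    by_cases hji : j = i
    · rw [hji, hzi]
    · exact (hz j hj hji).le⟩
  have hsub : ∀ x ∈ Q, ∀ y ∈ Q, x - y ∈ W := fun x hx y hy => by
    have := W.sub_mem ((hQmem x).1 hx).1 ((hQmem y).1 hy).1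
    rwa [sub_sub_sub_cancel_right] at this
  have hspanQ : vectorSpan ℝ Q = W := by
    apply le_antisymm
    · rw [vectorSpan_def, Submodule.span_le]
      rintro _ ⟨x, hx, y, hy, rfl⟩
      exact hsub x hx y hy
    · intro w hw
      obtain ⟨ε, hε, hlt⟩ := exists_pos_forall_add_smul_lt f b (p := (· ∈ J)) hx₀ w
      have h1 : x₀ + ε • w ∈ Q := (hQmem _).2
        ⟨by simpa using W.smul_mem ε hw, fun j hj => (hlt j hj).le⟩
      have h2 : x₀ ∈ Q := (hQmem _).2 ⟨by simp, fun j hj => (hx₀ j hj).le⟩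
      have h3 := vsub_mem_vectorSpan ℝ h1 h2
      simp only [vsub_eq_sub, add_sub_cancel_left] at h3
      exact (Submodule.smul_mem_iff _ hε.ne').1 h3
  have hspanF : vectorSpan ℝ {y ∈ Q | f i y = b i} = W ⊓ LinearMap.ker (f i) := by
    apply le_antisymm
    · rw [vectorSpan_def, Submodule.span_le]
      rintro _ ⟨x, hx, y, hy, rfl⟩
      exact ⟨hsub x hx.1 y hy.1, by simp [hx.2, hy.2]⟩
    · rintro w ⟨hw, hwi⟩
      have hwi' : f i w = 0 := hwi
      obtain ⟨ε, hε, hlt⟩ := exists_pos_forall_add_smul_lt f b (p := fun j => j ∈ J ∧ j ≠ i)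
        (fun j hj => hz j hj.1 hj.2) w
      have h1 : z + ε • w ∈ {y ∈ Q | f i y = b i} := by
        have he : f i (z + ε • w) = b i := by simp [hwi', hzi]
        refine ⟨(hQmem _).2 ⟨?_, fun j hj => ?_⟩, he⟩
        · rw [add_sub_right_comm]
          exact W.add_mem hzW (W.smul_mem ε hw)
        · by_cases hji : j = i
          · rw [hji, he]
          · exact (hlt j ⟨hj, hji⟩).le
      have h3 := vsub_mem_vectorSpan ℝ h1 (show z ∈ {y ∈ Q | f i y = b i} from ⟨hzQ, hzi⟩)
      simp only [vsub_eq_sub, add_sub_cancel_left] at h3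
      exact (Submodule.smul_mem_iff _ hε.ne').1 h3
  refine ⟨⟨z, hzQ, hzi⟩, fun _ => ⟨(f i).toContinuousLinearMap, ?_⟩, ?_⟩
  · ext y
    refine ⟨fun hy => ⟨hy.1, fun x hx => ?_⟩, fun hy => ⟨hy.1, ?_⟩⟩
    · simpa [hy.2] using ((hQmem x).1 hx).2 i hi
    · exact le_antisymm (((hQmem y).1 hy.1).2 i hi) (by simpa [hzi] using hy.2 z hzQ)
  · unfold dim
    rw [hspanF, hspanQ]
    refine finrank_inf_ker_add_one hzW ?_
    rw [map_sub, hzi]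
    exact (sub_pos.2 (hx₀ i hi)).ne'

/-- A nonempty polyhedron is described inside its affine hull by at most as many inequalities
as it has facets: in a minimal description every inequality defines a facet, and different
inequalities define different facets. -/
theorem IsPolyhedron.exists_facet_description {Q : Set (Fin q → ℝ)} (hQ : IsPolyhedron Q)
    (hne : Q.Nonempty) {n : ℕ} (hn : (facets Q).encard ≤ n) :
    ∃ (W : Submodule ℝ (Fin q → ℝ)) (x₀ : Fin q → ℝ) (ι : Type) (_ : Fintype ι)
      (f : ι → Dual ℝ (Fin q → ℝ)) (b : ι → ℝ), Fintype.card ι ≤ n ∧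
      Q = {y | y - x₀ ∈ W ∧ ∀ i, f i y ≤ b i} := by
  classical
  obtain ⟨ι, _, f, b, hQ⟩ := isPolyhedron_iff_isPolyhedral.1 hQ
  have hQmem : ∀ y, y ∈ Q ↔ ∀ i, f i y ≤ b i := fun y => by rw [hQ]; rfl
  have hconv : Convex ℝ Q := by
    rw [hQ, Set.ofPred_forall]
    exact convex_iInter fun i => convex_halfSpace_le (f i).isLinear (b i)
  let p : ι → Prop := fun i => ∃ y ∈ Q, f i y < b i
  have hp : ∀ i, ¬ p i → ∀ y ∈ Q, f i y = b i := fun i hi y hy =>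
    le_antisymm ((hQmem y).1 hy i) (not_lt.1 fun h => hi ⟨y, hy, h⟩)
  obtain ⟨x₀, hx₀, hlt⟩ := exists_forall_lt_of_convex hconv hne f b
    (fun x hx => (hQmem x).1 hx) (p := p) fun i hi => hi
  let W : Submodule ℝ (Fin q → ℝ) := ⨅ i : {i // ¬ p i}, LinearMap.ker (f i)
  have hW : ∀ y, y - x₀ ∈ W ↔ ∀ i, ¬ p i → f i y = b i := fun y => by
    simp only [W, Submodule.mem_iInf, Subtype.forall, LinearMap.mem_ker, map_sub, sub_eq_zero]
    exact forall₂_congr fun i hi => by rw [hp i hi x₀ hx₀]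
  let D : Finset ι → Prop := fun J =>
    (∀ i ∈ J, p i) ∧ Q = {y | y - x₀ ∈ W ∧ ∀ i ∈ J, f i y ≤ b i}
  have hD : ∃ J, D J := by
    refine ⟨Finset.univ.filter p, by simp, ?_⟩
    ext y
    rw [Set.mem_ofPred_eq, hW, hQmem]
    refine ⟨fun h => ⟨fun i hi => hp i hi y ((hQmem y).2 h), fun i _ => h i⟩, fun h i => ?_⟩
    by_cases hi : p i
    · exact h.2 i (by simpa using hi)
    · exact (h.1 i hi).le
  obtain ⟨J, hJ⟩ := exists_minimal_of_wellFoundedLT D hD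
  obtain ⟨hJp, hJQ⟩ := hJ.prop
  have hsep : ∀ i ∈ J, ∃ z, z - x₀ ∈ W ∧ f i z = b i ∧ ∀ j ∈ J, j ≠ i → f j z < b j := by
    intro i hi
    -- By minimality some `y` violates the `i`-th inequality only; `z` is the point where the
    -- segment from `x₀` to `y` leaves `Q`.
    obtain ⟨y, hyW, hyJ, hyi⟩ : ∃ y, y - x₀ ∈ W ∧ (∀ j ∈ J, j ≠ i → f j y ≤ b j) ∧
        b i < f i y := by
      by_contra! H
      refine hJ.not_prop_of_lt (Finset.erase_ssubset hi)
        ⟨fun j hj => hJp j (Finset.mem_of_mem_erase hj), ?_⟩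
      rw [hJQ]
      ext y
      refine ⟨fun h => ⟨h.1, fun j hj => h.2 j (Finset.mem_of_mem_erase hj)⟩,
        fun h => ⟨h.1, fun j hj => ?_⟩⟩
      have h' : ∀ j ∈ J, j ≠ i → f j y ≤ b j := fun j hj hji =>
        h.2 j (Finset.mem_erase.2 ⟨hji, hj⟩)
      by_cases hji : j = i
      · exact hji ▸ H y h.1 h'
      · exact h' j hj hji
    have h0 : f i x₀ < b i := hlt i (hJp i hi)
    have hpos : 0 < f i y - f i x₀ := by linarith
    set t := (b i - f i x₀) / (f i y - f i x₀) with ht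
    have ht0 : 0 < t := div_pos (by linarith) hpos
    have ht1 : t < 1 := (div_lt_one hpos).2 (by linarith)
    have htm : t * (f i y - f i x₀) = b i - f i x₀ := div_mul_cancel₀ _ hpos.ne'
    refine ⟨x₀ + t • (y - x₀), by simpa using W.smul_mem t hyW, ?_, fun j hj hji => ?_⟩
    · simp only [map_add, map_smul, map_sub, smul_eq_mul]
      linarith
    · simp only [map_add, map_smul, map_sub, smul_eq_mul]
      have h1 := hyJ j hj hji
      have h2 := hlt j (hJp j hj)
      nlinarith
  refine ⟨W, x₀, J, inferInstance, fun i => f i, fun i => b i, ?_, ?_⟩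
  · rw [Fintype.card_coe]
    have : (J : Set ι).encard ≤ (facets Q).encard := by
      refine Set.encard_le_encard_of_injOn (f := fun i => {y ∈ Q | f i y = b i}) ?_ ?_
      · intro i hi
        obtain ⟨z, h1, h2, h3⟩ := hsep i hi
        exact mem_facets_of_strict (J := (J : Set ι)) hJQ (fun i hi => hlt i (hJp i hi)) hi
          h1 h2 h3
      · intro i hi j hj hij
        by_contra hne
        obtain ⟨z, h1, h2, h3⟩ := hsep i hi
        have hz : z ∈ {y ∈ Q | f i y = b i} := by
          refine ⟨?_, h2⟩
          rw [hJQ]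
          refine ⟨h1, fun k hk => ?_⟩
          by_cases hki : k = i
          · rw [hki, h2]
          · exact (h3 k hk hki).le
        have hz' : z ∈ {y ∈ Q | f j y = b j} := by
          rwa [show {y ∈ Q | f j y = b j} = {y ∈ Q | f i y = b i} from hij.symm]
        exact (h3 j hj (Ne.symm hne)).ne hz'.2
    have := this.trans hn
    rw [Set.encard_coe_eq_coe_finsetCard] at this
    exact_mod_cast this
  · rw [hJQ]
    simp only [Subtype.forall]

end ExtForm

/-! ### Slices of orthants -/

namespace ExtForm

open Module Filter

variable {p : ℕ}

theorem eq_zero_of_isBounded_ray {P : Set (Fin p → ℝ)} (hP : Bornology.IsBounded P)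
    {x v : Fin p → ℝ} (h : ∀ t : ℝ, 0 ≤ t → x + t • v ∈ P) : v = 0 := by
  by_contra hv
  obtain ⟨C, hC⟩ := hP.exists_norm_le
  have hv' : 0 < ‖v‖ := norm_pos_iff.2 hv
  have hC0 : 0 ≤ C := (norm_nonneg _).trans (hC _ (h 0 le_rfl))
  have ht : 0 ≤ (C + ‖x‖ + 1) / ‖v‖ := by positivity
  have h1 := hC _ (h _ ht)
  have h2 : ‖((C + ‖x‖ + 1) / ‖v‖) • v‖ = C + ‖x‖ + 1 := by
    rw [norm_smul, Real.norm_of_nonneg ht, div_mul_cancel₀ _ hv'.ne']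
  have h3 := norm_sub_le (x + ((C + ‖x‖ + 1) / ‖v‖) • v) x
  rw [add_sub_cancel_left, h2] at h3
  linarith

theorem exists_factor_through_range {W F G : Type*} [AddCommGroup W] [Module ℝ W]
    [AddCommGroup F] [Module ℝ F] [AddCommGroup G] [Module ℝ G] (α : W →ₗ[ℝ] F) (π : W →ₗ[ℝ] G)
    (h : LinearMap.ker α ≤ LinearMap.ker π) : ∃ ρ : F →ₗ[ℝ] G, ∀ w, ρ (α w) = π w := by
  obtain ⟨g, hg⟩ := α.rangeRestrict.exists_rightInverse_of_surjective α.range_rangeRestrict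
  obtain ⟨ρ, hρ⟩ := LinearMap.exists_extend (π ∘ₗ g)
  refine ⟨ρ, fun w => ?_⟩
  have h1 : ρ (α w) = π (g (α.rangeRestrict w)) := LinearMap.congr_fun hρ (α.rangeRestrict w)
  have h2 : α (g (α.rangeRestrict w)) = α w :=
    congrArg Subtype.val (LinearMap.congr_fun hg (α.rangeRestrict w))
  rw [h1, ← sub_eq_zero, ← map_sub]
  exact h (by simp [h2])

/-- A presentation of `P` as the image `p₀ + ρ {u ∈ U | u ≤ β}` of a slice of a shifted negative
orthant by a subspace `U` of `ℝ^ι` which contains no nonzero vector `u ≤ 0`. Up to the sign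
change `s = β - u`, this is the slack description of an extension of `P` by a bounded
polyhedron. -/
structure Slice (P : Set (Fin p → ℝ)) (ι : Type) where
  /-- the directions of the slice -/
  U : Submodule ℝ (ι → ℝ)
  /-- the linear part of the projection -/
  ρ : (ι → ℝ) →ₗ[ℝ] (Fin p → ℝ)
  /-- the image of the origin -/
  p₀ : Fin p → ℝ
  /-- the right hand sides -/
  β : ι → ℝ
  mem_iff : ∀ x, x ∈ P ↔ ∃ u ∈ U, u ≤ β ∧ p₀ + ρ u = x
  eq_zero : ∀ u ∈ U, u ≤ 0 → u = 0

/-- Take a minimal subsystem of the inequalities whose solution set still projects onto `P`. A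
direction `w` along which no inequality of the subsystem gets violated projects to `0`, as `P` is
bounded. If `w` strictly relaxed some inequalities, they could be dropped: translating by
a large multiple of `w` restores them without changing the projection. -/
theorem exists_slice {q : ℕ} {P : Set (Fin p → ℝ)} (hb : Bornology.IsBounded P)
    (hne : P.Nonempty) (π : (Fin q → ℝ) →ₗ[ℝ] (Fin p → ℝ)) (W : Submodule ℝ (Fin q → ℝ))
    (x₀ : Fin q → ℝ) {ι : Type} [Finite ι] (f : ι → Dual ℝ (Fin q → ℝ)) (b : ι → ℝ)
    (hP : P = π '' {y | y - x₀ ∈ W ∧ ∀ i, f i y ≤ b i}) :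
    ∃ J : Finset ι, Nonempty (Slice P J) := by
  classical
  have := Fintype.ofFinite ι
  let D : Finset ι → Prop := fun J => P = π '' {y | y - x₀ ∈ W ∧ ∀ i ∈ J, f i y ≤ b i}
  obtain ⟨J, hJ⟩ := exists_minimal_of_wellFoundedLT D ⟨Finset.univ, by simpa [D] using hP⟩
  have hJP : P = π '' {y | y - x₀ ∈ W ∧ ∀ i ∈ J, f i y ≤ b i} := hJ.prop
  have hrec : ∀ w ∈ W, (∀ i ∈ J, f i w ≤ 0) → π w = 0 := by
    intro w hw hle
    obtain ⟨x, hx⟩ := hne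
    rw [hJP] at hx
    obtain ⟨y, hy, rfl⟩ := hx
    refine eq_zero_of_isBounded_ray hb (x := π y) fun t ht => ?_
    rw [hJP]
    refine ⟨y + t • w, ⟨?_, fun i hi => ?_⟩, by simp⟩
    · rw [add_sub_right_comm]
      exact W.add_mem hy.1 (W.smul_mem t hw)
    · have h1 := mul_nonpos_of_nonneg_of_nonpos ht (hle i hi)
      have h2 := hy.2 i hi
      simp only [map_add, map_smul, smul_eq_mul]
      linarith
  have hred : ∀ w ∈ W, (∀ i ∈ J, f i w ≤ 0) → ∀ i ∈ J, f i w = 0 := by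
    intro w hw hle
    by_contra! hex
    obtain ⟨k, hk, hkne⟩ := hex
    refine hJ.not_prop_of_lt (y := J.filter fun i => f i w = 0) ?_ ?_
    · exact Finset.filter_ssubset.2 ⟨k, hk, hkne⟩
    · change P = _
      apply Set.Subset.antisymm
      · rw [hJP]
        exact Set.image_mono fun y hy => ⟨hy.1, fun i hi => hy.2 i (Finset.mem_filter.1 hi).1⟩
      · rintro _ ⟨y, hy, rfl⟩
        have hev : ∀ᶠ t : ℝ in atTop, ∀ i : J, f i w < 0 → f i y + t * f i w ≤ b i := by
          rw [eventually_all]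
          rintro ⟨i, hi⟩
          filter_upwards [eventually_ge_atTop ((b i - f i y) / f i w)] with t ht hneg
          have := (div_le_iff_of_neg hneg).1 ht
          linarith
        obtain ⟨t, ht⟩ := hev.exists
        rw [hJP]
        refine ⟨y + t • w, ⟨?_, fun i hi => ?_⟩, by simp [hrec w hw hle]⟩
        · rw [add_sub_right_comm]
          exact W.add_mem hy.1 (W.smul_mem t hw)
        · simp only [map_add, map_smul, smul_eq_mul]
          rcases (hle i hi).lt_or_eq with h | h
          · exact ht ⟨i, hi⟩ h
          · simpa [h] using hy.2 i (Finset.mem_filter.2 ⟨hi, h⟩)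
  let α : W →ₗ[ℝ] (J → ℝ) := LinearMap.pi fun i => f i ∘ₗ W.subtype
  have hα : ∀ w i, α w i = f i w := fun w i => rfl
  obtain ⟨ρ, hρ⟩ := exists_factor_through_range α (π ∘ₗ W.subtype) fun w hw =>
    hrec w w.2 fun i hi => (congrFun hw ⟨i, hi⟩).le
  refine ⟨J, ⟨⟨LinearMap.range α, ρ, π x₀, fun i => b i - f i x₀, fun x => ?_, ?_⟩⟩⟩
  · rw [hJP]
    constructor
    · rintro ⟨y, hy, rfl⟩
      refine ⟨α ⟨y - x₀, hy.1⟩, ⟨_, rfl⟩, fun i => ?_, ?_⟩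
      · simpa [hα] using hy.2 i i.2
      · rw [hρ]
        simp
    · rintro ⟨_, ⟨w, rfl⟩, hle, rfl⟩
      refine ⟨x₀ + w, ⟨by simp, fun i hi => ?_⟩, by rw [hρ]; simp⟩
      have := hle ⟨i, hi⟩
      rw [hα] at this
      rw [map_add]
      linarith
  · rintro _ ⟨w, rfl⟩ hle
    ext i
    exact hred w w.2 (fun i hi => hle ⟨i, hi⟩) i i.2

namespace Slice

variable {P : Set (Fin p → ℝ)} {ι : Type} (S : Slice P ι)

theorem vectorSpan_le : vectorSpan ℝ P ≤ S.U.map S.ρ := by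
  rw [vectorSpan_def, Submodule.span_le]
  rintro _ ⟨x, hx, y, hy, rfl⟩
  obtain ⟨u, hu, _, rfl⟩ := (S.mem_iff x).1 hx
  obtain ⟨v, hv, _, rfl⟩ := (S.mem_iff y).1 hy
  exact ⟨u - v, S.U.sub_mem hu hv, by simp⟩

variable [Fintype ι]

theorem dim_le : dim P ≤ finrank ℝ S.U :=
  (Submodule.finrank_mono S.vectorSpan_le).trans (Submodule.finrank_map_le _ _)

theorem finrank_lt [Nonempty ι] : finrank ℝ S.U < Fintype.card ι := by
  rw [← finrank_fintype_fun_eq_card ℝ]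
  refine Submodule.finrank_lt fun h => ?_
  have h1 := S.eq_zero (-1) (by rw [h]; trivial) (by simp)
  simpa using congrFun h1 (Classical.arbitrary ι)

/-- If the projection is injective on the directions of the slice, then `P` is an affine copy of
the slice, which is given by `#ι` inequalities. -/
theorem encard_facets_le_card (h : finrank ℝ S.U = dim P) :
    (facets P).encard ≤ Fintype.card ι := by
  have hinj : Function.Injective (S.ρ.domRestrict S.U) := by
    rw [← LinearMap.ker_eq_bot, ← Submodule.finrank_eq_zero (R := ℝ)]
    have h1 := (S.ρ.domRestrict S.U).finrank_range_add_finrank_ker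
    rw [LinearMap.range_domRestrict] at h1
    have h2 : dim P ≤ _ := Submodule.finrank_mono S.vectorSpan_le
    omega
  obtain ⟨g, hg⟩ := (S.ρ.domRestrict S.U).exists_leftInverse_of_injective
    (LinearMap.ker_eq_bot.2 hinj)
  have hg' : ∀ u : S.U, g (S.ρ u) = u := fun u => LinearMap.congr_fun hg u
  refine encard_facets_le (W := S.U.map S.ρ) (x₀ := S.p₀)
    (f := fun i => LinearMap.proj i ∘ₗ S.U.subtype ∘ₗ g)
    (b := fun i => S.β i + (g S.p₀ : ι → ℝ) i) ?_
  ext x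
  rw [S.mem_iff]
  constructor
  · rintro ⟨u, hu, hle, rfl⟩
    refine ⟨⟨u, hu, by simp⟩, fun i => ?_⟩
    have := hle i
    simp only [LinearMap.comp_apply, map_add, hg' ⟨u, hu⟩]
    simp
    linarith
  · rintro ⟨⟨u, hu, hux⟩, hle⟩
    obtain rfl : S.p₀ + S.ρ u = x := by rw [hux]; abel
    refine ⟨u, hu, fun i => ?_, rfl⟩
    have := hle i
    simp only [LinearMap.comp_apply, map_add, hg' ⟨u, hu⟩] at this
    simp at this
    linarith

/-- If the directions of the slice form a hyperplane, then it is the kernel of a functional with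
positive coefficients, since it contains no nonzero vector of the negative orthant. -/
theorem exists_pos_functional [DecidableEq ι] (h : finrank ℝ S.U + 1 = Fintype.card ι) :
    ∃ c : Dual ℝ (ι → ℝ), LinearMap.ker c = S.U ∧ ∀ i, 0 < c (Pi.single i 1) := by
  rw [← finrank_fintype_fun_eq_card ℝ] at h
  have hlt : S.U < ⊤ := lt_top_iff_ne_top.2 fun hU => by
    rw [hU, finrank_top] at h
    omega
  obtain ⟨c, hc, hle⟩ := Submodule.exists_le_ker_of_lt_top _ hlt
  have hker : S.U = LinearMap.ker c := Submodule.eq_of_le_of_finrank_eq hle (by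
    have := Module.Dual.finrank_ker_add_one_of_ne_zero hc
    omega)
  have hne : ∀ i, c (Pi.single i 1) ≠ 0 := by
    intro i hi
    have h1 := S.eq_zero (-Pi.single i 1) (by rw [hker]; simp [hi])
      (neg_nonpos.2 (Pi.single_nonneg.2 zero_le_one))
    simpa using congrFun h1 i
  have : Nonempty ι := by
    by_contra hemp
    rw [not_nonempty_iff] at hemp
    exact hc (LinearMap.ext fun x => by rw [Subsingleton.elim x 0]; simp)
  let k : ι := Classical.arbitrary ι
  set r := c (Pi.single k 1) with hr
  -- Multiplying by its value at one coordinate vector gives `c` the right sign.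
  have hkerr : LinearMap.ker (r • c) = S.U := by rw [hker, LinearMap.ker_smul _ _ (hne k)]
  refine ⟨r • c, hkerr, fun j => ?_⟩
  have hrr : 0 < r * r := mul_self_pos.2 (hne k)
  by_contra! hj
  have hjk : j ≠ k := by
    rintro rfl
    simp only [LinearMap.smul_apply, smul_eq_mul] at hj
    exact absurd hj (not_le.2 hrr)
  have h1 := S.eq_zero (Pi.single k ((r • c) (Pi.single j 1)) - Pi.single j (r * r)) (by
      have e : ∀ i (a : ℝ), (Pi.single i a : ι → ℝ) = a • Pi.single i 1 := fun i a => by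
        rw [← Pi.single_smul, smul_eq_mul, mul_one]
      rw [hker, LinearMap.mem_ker, map_sub, e k, e j (r * r), map_smul, map_smul, ← hr]
      simp only [LinearMap.smul_apply, smul_eq_mul]
      ring)
    (sub_nonpos.2 ((Pi.single_nonpos.2 hj).trans (Pi.single_nonneg.2 hrr.le)))
  have h2 := congrFun h1 j
  simp [hjk] at h2
  exact hne k h2

/-- A bounded hyperplane slice of an orthant is a simplex (or a point), so `P` is the convex hull
of the images of its vertices. -/
theorem exists_eq_convexHull (hne : P.Nonempty) (h : finrank ℝ S.U + 1 = Fintype.card ι) :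
    ∃ v : ι → (Fin p → ℝ), P = convexHull ℝ (Set.range v) := by
  classical
  obtain ⟨c, hker, hpos⟩ := S.exists_pos_functional h
  have hmem : ∀ u, u ∈ S.U ↔ c u = 0 := fun u => by rw [← hker]; rfl
  have hsum : ∀ s : ι → ℝ, c s = ∑ i, s i * c (Pi.single i 1) := fun s => by
    conv_lhs => rw [pi_eq_sum_univ' s]
    simp [map_sum]
  have hnonneg : ∀ s : ι → ℝ, 0 ≤ s → ∀ i, 0 ≤ s i * c (Pi.single i 1) :=
    fun s hs i => mul_nonneg (hs i) (hpos i).le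
  set δ := c S.β with hδ
  have hδ0 : 0 ≤ δ := by
    obtain ⟨x, hx⟩ := hne
    obtain ⟨u, hu, hle, -⟩ := (S.mem_iff x).1 hx
    have h1 := hsum (S.β - u)
    rw [map_sub, (hmem u).1 hu, sub_zero] at h1
    rw [hδ, h1]
    exact Finset.sum_nonneg fun i _ => hnonneg _ (sub_nonneg.2 hle) i
  have hι : Nonempty ι := Fintype.card_pos_iff.1 (by omega)
  let e : ι → (ι → ℝ) := fun i => (δ / c (Pi.single i 1)) • Pi.single i 1
  refine ⟨fun i => S.p₀ + S.ρ (S.β - e i), Set.Subset.antisymm ?_ ?_⟩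
  · intro x hx
    obtain ⟨u, hu, hle, rfl⟩ := (S.mem_iff x).1 hx
    set s := S.β - u with hs
    have hs0 : 0 ≤ s := sub_nonneg.2 hle
    have hcs : ∑ i, s i * c (Pi.single i 1) = δ := by
      rw [← hsum, hs, map_sub, (hmem u).1 hu, sub_zero]
    rw [show u = S.β - s by rw [hs]; abel]
    rcases hδ0.eq_or_lt with h0 | h0
    · have hsz : s = 0 := by
        rw [← h0, Finset.sum_eq_zero_iff_of_nonneg fun i _ => hnonneg s hs0 i] at hcs
        ext i
        simpa [(hpos i).ne'] using hcs i (Finset.mem_univ i)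
      refine subset_convexHull ℝ _ ⟨Classical.arbitrary ι, ?_⟩
      simp [e, ← h0, hsz]
    · let w : ι → ℝ := fun i => s i * c (Pi.single i 1) / δ
      have hw : ∑ i, w i = 1 := by
        rw [← Finset.sum_div, hcs, div_self h0.ne']
      have hws : ∑ i, w i • e i = s := by
        conv_rhs => rw [pi_eq_sum_univ' s]
        refine Finset.sum_congr rfl fun i _ => ?_
        have := (hpos i).ne'
        rw [smul_smul]
        congr 1
        simp only [w]
        field_simp
      have key : ∑ i, w i • (S.p₀ + S.ρ (S.β - e i)) = S.p₀ + S.ρ (S.β - s) := by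
        simp only [map_sub, smul_add, smul_sub, Finset.sum_add_distrib, Finset.sum_sub_distrib,
          ← Finset.sum_smul, hw, one_smul]
        rw [← hws]
        simp [map_sum]
      rw [← key]
      exact (convex_convexHull ℝ _).sum_mem (fun i _ => div_nonneg (hnonneg s hs0 i) hδ0) hw
        fun i _ => subset_convexHull ℝ _ ⟨i, rfl⟩
  · refine convexHull_min ?_ ?_
    · rintro _ ⟨i, rfl⟩
      refine (S.mem_iff _).2 ⟨S.β - e i, ?_, ?_, rfl⟩
      · rw [hmem, map_sub, ← hδ, map_smul, smul_eq_mul, div_mul_cancel₀ _ (hpos i).ne', sub_self]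
      · exact sub_le_self _ (smul_nonneg (div_nonneg hδ0 (hpos i).le)
          (Pi.single_nonneg.2 zero_le_one))
    · intro x hx y hy a b ha hb hab
      obtain ⟨u, hu, hule, rfl⟩ := (S.mem_iff x).1 hx
      obtain ⟨v, hv, hvle, rfl⟩ := (S.mem_iff y).1 hy
      refine (S.mem_iff _).2 ⟨a • u + b • v,
        S.U.add_mem (S.U.smul_mem a hu) (S.U.smul_mem b hv), ?_, ?_⟩
      · exact convex_Iic (𝕜 := ℝ) S.β hule hvle ha hb hab
      · rw [smul_add, smul_add, add_add_add_comm, ← add_smul, hab, one_smul]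
        simp

end Slice

end ExtForm

/-! ### Extension complexity -/

namespace ExtForm

open Module

variable {p : ℕ} {P : Set (Fin p → ℝ)}

theorem IsPolytope.isBounded (hP : IsPolytope P) : Bornology.IsBounded P := by
  obtain ⟨V, hV, rfl⟩ := hP
  exact isBounded_convexHull.2 hV.isBounded

theorem nonempty_of_dim_pos (h : 1 ≤ dim P) : P.Nonempty := by
  by_contra hne
  rw [Set.not_nonempty_iff_eq_empty] at hne
  simp [dim, hne] at h

theorem encard_vertices_convexHull_range_le {ι : Type*} [Fintype ι] (v : ι → (Fin p → ℝ)) :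
    (vertices (convexHull ℝ (Set.range v))).encard ≤ Fintype.card ι :=
  calc (vertices (convexHull ℝ (Set.range v))).encard ≤ (Set.range v).encard :=
        Set.encard_le_encard extremePoints_convexHull_subset
    _ ≤ (Set.univ : Set ι).encard := by
        rw [← Set.image_univ]
        exact Set.encard_image_le _ _
    _ = Fintype.card ι := by simp [Set.encard_univ]

theorem dim_convexHull (s : Set (Fin p → ℝ)) :
    dim (convexHull ℝ s) = finrank ℝ (vectorSpan ℝ s) := by
  rw [dim, ← direction_affineSpan, affineSpan_convexHull, direction_affineSpan]

theorem isSimplex_of_card_eq {ι : Type*} [Fintype ι] {v : ι → (Fin p → ℝ)}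
    (hP : P = convexHull ℝ (Set.range v)) (hcard : Fintype.card ι = dim P + 1) :
    IsSimplex P := by
  have hv : AffineIndependent ℝ v := by
    rw [affineIndependent_iff_finrank_vectorSpan_eq ℝ v hcard, ← dim_convexHull, ← hP]
  let e := Fintype.equivFinOfCardEq hcard
  refine ⟨dim P, ⟨v ∘ e.symm, hv.comp_embedding e.symm.toEmbedding⟩, ?_⟩
  rw [e.symm.surjective.range_comp]
  exact hP

theorem IsSimplex.encard_vertices_le (h : IsSimplex P) :
    (vertices P).encard ≤ (dim P : ℕ∞) + 1 := by
  obtain ⟨n, s, rfl⟩ := h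
  have hn : dim (convexHull ℝ (Set.range s.points)) = n := by
    rw [dim_convexHull, s.independent.finrank_vectorSpan (Fintype.card_fin _)]
  rw [hn]
  simpa using encard_vertices_convexHull_range_le s.points

theorem xc_le_of_isExtension {q : ℕ} {Q : Set (Fin q → ℝ)} {π : (Fin q → ℝ) →ₗ[ℝ] (Fin p → ℝ)}
    (h : IsExtension P Q π) : xc P ≤ (facets Q).encard :=
  sInf_le ⟨q, Q, π, h, rfl⟩

theorem exists_isExtension_of_xc_le {n : ℕ} (h : xc P ≤ n) :
    ∃ (q : ℕ) (Q : Set (Fin q → ℝ)) (π : (Fin q → ℝ) →ₗ[ℝ] (Fin p → ℝ)),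
      IsExtension P Q π ∧ (facets Q).encard ≤ n := by
  have hne : {n | ∃ (q : ℕ) (Q : Set (Fin q → ℝ)) (π : (Fin q → ℝ) →ₗ[ℝ] (Fin p → ℝ)),
      IsExtension P Q π ∧ n = (facets Q).encard}.Nonempty := by
    by_contra hemp
    rw [Set.not_nonempty_iff_eq_empty] at hemp
    rw [xc, hemp, sInf_empty] at h
    exact absurd h (by simp)
  obtain ⟨q, Q, π, hQ, heq⟩ := csInf_mem hne
  exact ⟨q, Q, π, hQ, heq ▸ h⟩

theorem IsPolytope.xc_le_encard_facets (hP : IsPolytope P) : xc P ≤ (facets P).encard :=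
  xc_le_of_isExtension (π := LinearMap.id) ⟨hP.isPolyhedron, by simp⟩

/-- The standard simplex with `k` vertices has at most `k` facets. -/
theorem encard_facets_stdSimplex_le {k : ℕ} (hk : k ≠ 0) :
    (facets (stdSimplex ℝ (Fin k))).encard ≤ k := by
  have : NeZero k := ⟨hk⟩
  have h := encard_facets_le (Q := stdSimplex ℝ (Fin k))
    (W := LinearMap.ker (∑ i, LinearMap.proj i : Dual ℝ (Fin k → ℝ)))
    (x₀ := Pi.single 0 1) (f := fun i => -LinearMap.proj i) (b := fun _ => 0) (by
      ext x
      simp [stdSimplex, sub_eq_zero, and_comm])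
  simpa using h

theorem isPolyhedron_stdSimplex (k : ℕ) : IsPolyhedron (stdSimplex ℝ (Fin k)) := by
  rw [isPolyhedron_iff_isPolyhedral]
  have h : IsPolyhedral {x : Fin k → ℝ | ∀ i, 0 ≤ x i} :=
    ⟨Fin k, inferInstance, fun i => -LinearMap.proj i, fun _ => 0, by ext x; simp⟩
  convert h.inter (isPolyhedral_setOf_eq (∑ i, LinearMap.proj i) 1) using 1
  ext x
  simp [stdSimplex]

/-- A polytope with `k` vertices is the projection of the standard simplex with `k` vertices. -/
theorem IsPolytope.xc_le_encard_vertices (hP : IsPolytope P) (hne : P.Nonempty) :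
    xc P ≤ (vertices P).encard := by
  obtain ⟨V, hV, hPV⟩ := hP
  have hfin : (vertices P).Finite := by
    rw [hPV]
    exact hV.subset extremePoints_convexHull_subset
  have hcomp : IsCompact P := by
    rw [hPV]
    exact hV.isCompact_convexHull ℝ
  have hconv : Convex ℝ P := by
    rw [hPV]
    exact convex_convexHull ℝ V
  have hhull : convexHull ℝ (vertices P) = P :=
    (hfin.isClosed_convexHull ℝ).closure_eq.symm.trans
      (closure_convexHull_extremePoints hcomp hconv)
  have hcard := hfin.encard_eq_coe_toFinset_card
  set k := hfin.toFinset.card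
  have hk : k ≠ 0 := by
    intro h0
    rw [h0, Nat.cast_zero, Set.encard_eq_zero] at hcard
    rw [← hhull, hcard, convexHull_empty] at hne
    exact Set.not_nonempty_empty hne
  let e := hfin.toFinset.equivFin.symm
  let v : Fin k → (Fin p → ℝ) := fun i => (e i : Fin p → ℝ)
  have hrange : Set.range v = vertices P := by
    rw [show v = Subtype.val ∘ e from rfl, e.surjective.range_comp]
    simp
  rw [hcard]
  refine (xc_le_of_isExtension (Q := stdSimplex ℝ (Fin k))
    (π := Fintype.linearCombination ℝ v) ⟨isPolyhedron_stdSimplex k, ?_⟩).trans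
    (encard_facets_stdSimplex_le hk)
  rw [← convexHull_rangle_single_eq_stdSimplex, LinearMap.image_convexHull, ← Set.range_comp]
  refine Eq.trans ?_ hhull
  rw [← hrange]
  congr 2
  ext1 i
  simp [Fintype.linearCombination_apply_single]

/-- A bounded set with an extension of size at most `n` has a slice presentation with at most `n`
inequalities. -/
theorem exists_slice_of_xc_le (hb : Bornology.IsBounded P) (hne : P.Nonempty) {n : ℕ}
    (h : xc P ≤ n) : ∃ (ι : Type) (_ : Fintype ι), Fintype.card ι ≤ n ∧ Nonempty (Slice P ι) := by
  obtain ⟨q, Q, π, ⟨hQ, hπ⟩, hn⟩ := exists_isExtension_of_xc_le h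
  have hQne : Q.Nonempty := by
    rw [← hπ] at hne
    exact hne.of_image
  obtain ⟨W, x₀, ι, _, f, b, hι, hQeq⟩ := hQ.exists_facet_description hQne hn
  obtain ⟨J, hJ⟩ := exists_slice hb hne π W x₀ f b (by rw [← hQeq, hπ])
  exact ⟨J, inferInstance,
    (Fintype.card_coe J).trans_le ((Finset.card_le_univ J).trans hι), hJ⟩

theorem Slice.dim_add_one_le_card {ι : Type} [Fintype ι] (S : Slice P ι) (hd : 1 ≤ dim P) :
    dim P + 1 ≤ Fintype.card ι := by
  have h1 := S.dim_le
  have : Nonempty ι := by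
    by_contra hemp
    rw [not_nonempty_iff] at hemp
    have := Submodule.finrank_le S.U
    rw [finrank_fintype_fun_eq_card, Fintype.card_eq_zero] at this
    omega
  have h2 := S.finrank_lt
  omega

theorem dim_add_one_le_xc (hb : Bornology.IsBounded P) (hd : 1 ≤ dim P) :
    (dim P : ℕ∞) + 1 ≤ xc P := by
  rcases eq_or_ne (xc P) ⊤ with htop | htop
  · simp [htop]
  · obtain ⟨n, hn⟩ := ENat.ne_top_iff_exists.1 htop
    obtain ⟨ι, _, hι, ⟨S⟩⟩ := exists_slice_of_xc_le hb (nonempty_of_dim_pos hd) hn.ge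
    rw [← hn]
    exact_mod_cast (S.dim_add_one_le_card hd).trans hι

theorem isSimplex_of_xc_le (hb : Bornology.IsBounded P) (hd : 1 ≤ dim P)
    (h : xc P ≤ (dim P : ℕ∞) + 1) : IsSimplex P := by
  have hne := nonempty_of_dim_pos hd
  obtain ⟨ι, _, hι, ⟨S⟩⟩ := exists_slice_of_xc_le hb hne (n := dim P + 1) (by exact_mod_cast h)
  have hcard := hι.antisymm (S.dim_add_one_le_card hd)
  have : Nonempty ι := Fintype.card_pos_iff.1 (by omega)
  have h1 := S.dim_le
  have h2 := S.finrank_lt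
  obtain ⟨v, hv⟩ := S.exists_eq_convexHull hne (by omega)
  exact isSimplex_of_card_eq hv hcard

/-- An extension of size `dim P + 2` yields a slice of dimension `dim P`, which is an affine copy
of `P`, or of dimension `dim P + 1`, which is a simplex projecting onto `P`. -/
theorem min_le_of_xc_le (hb : Bornology.IsBounded P) (hd : 1 ≤ dim P)
    (h : xc P ≤ (dim P : ℕ∞) + 2) :
    min (facets P).encard (vertices P).encard ≤ (dim P : ℕ∞) + 2 := by
  have hne := nonempty_of_dim_pos hd
  obtain ⟨ι, _, hι, ⟨S⟩⟩ := exists_slice_of_xc_le hb hne (n := dim P + 2) (by exact_mod_cast h)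
  have hcard := S.dim_add_one_le_card hd
  have hι' : (Fintype.card ι : ℕ∞) ≤ (dim P : ℕ∞) + 2 := by exact_mod_cast hι
  have : Nonempty ι := Fintype.card_pos_iff.1 (by omega)
  have h1 := S.dim_le
  have h2 := S.finrank_lt
  by_cases hU : finrank ℝ S.U = dim P
  · exact (min_le_left _ _).trans ((S.encard_facets_le_card hU).trans hι')
  · obtain ⟨v, hv⟩ := S.exists_eq_convexHull hne (by omega)
    refine (min_le_right _ _).trans (le_trans ?_ hι')
    rw [hv]
    exact encard_vertices_convexHull_range_le v

end ExtForm

theorem mainTheorem7 (p d : ℕ) (P : Set (Fin p → ℝ)) (hP : ExtForm.IsPolytope P)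
    (hd : 1 ≤ d) (hdim : ExtForm.dim P = d) :
    ((d : ℕ∞) + 1 ≤ ExtForm.xc P) ∧
    (ExtForm.xc P = (d : ℕ∞) + 1 ↔ ExtForm.IsSimplex P) ∧
    (ExtForm.xc P = (d : ℕ∞) + 2 ↔
      min (ExtForm.facets P).encard (ExtForm.vertices P).encard = (d : ℕ∞) + 2) := by
  subst hdim
  have hb := hP.isBounded
  have hne := ExtForm.nonempty_of_dim_pos hd
  have hlow := ExtForm.dim_add_one_le_xc hb hd
  have hv := hP.xc_le_encard_vertices hne
  have hmin := le_min hP.xc_le_encard_facets hv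
  have hlt : (ExtForm.dim P : ℕ∞) + 1 < (ExtForm.dim P : ℕ∞) + 2 := by
    exact_mod_cast Nat.lt_succ_self _
  refine ⟨hlow, ⟨fun h => ExtForm.isSimplex_of_xc_le hb hd h.le,
    fun h => (hv.trans h.encard_vertices_le).antisymm hlow⟩, ⟨fun h => ?_, fun h => ?_⟩⟩
  · exact (ExtForm.min_le_of_xc_le hb hd h.le).antisymm (h ▸ hmin)
  · refine (h ▸ hmin).antisymm ?_
    by_contra hcon
    -- An extension with fewer facets would make `P` a simplex, which has too few vertices.
    have hle : ExtForm.xc P ≤ (ExtForm.dim P : ℕ∞) + 1 := by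
      rw [not_le] at hcon
      refine Order.le_of_lt_succ ?_
      rwa [Order.succ_eq_add_one, add_assoc, one_add_one_eq_two]
    have hs := (ExtForm.isSimplex_of_xc_le hb hd hle).encard_vertices_le
    exact absurd (h ▸ (min_le_right _ _).trans hs) (not_le.2 hlt)
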